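/- Let $\mathbb H$ be the skew field of real quaternions and let $\mathbb H[[z]]$ be the ring of formal power series $f(z)=\sum_{k\ge 0} z^k f_k$, $f_k\in\mathbb H$, in a variable $z$ commuting with the coefficients. Let $\mathcal H_1$ be the set of all $f\in\mathbb H[[z]]$ with $\limsup_{k\to\infty}|f_k|^{1/k}\le 1$; for $f\in\mathcal H_1$ and $\gamma\in\mathbb H$ with $|\gamma|<1$ put $f^{\boldsymbol{e_\ell}}(\gamma)=\sum_{k\ge0}\gamma^k f_k$ and $f^{\boldsymbol{e_r}}(\gamma)=\sum_{k\ge0}f_k\gamma^k$. For $\alpha\in\mathbb H$ with $|\alpha|<1$ let $\mathbf b_\alpha(z)=(z-\alpha)\sum_{k\ge0}\overline{\alpha}^k z^k$. A finite Blaschke product is a power series of the form $\mathbf b_{\alpha_1}\mathbf b_{\alpha_2}\cdots\mathbf b_{\alpha_n}\phi$ with $n\ge 0$, $\alpha_1,\dots,\alpha_n,\phi\in\mathbb H$, $|\alpha_i|<1$ for all $i$, and $|\phi|=1$. Theorem. Let $f\in\mathcal H_1$. If $$\lim_{|\gamma|\to1^-}|f^{\boldsymbol{e_\ell}}(\gamma)|=1,$$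 then $f$ is a finite Blaschke product. Moreover, this condition holds if and only if $$\lim_{|\gamma|\to1^-}|f^{\boldsymbol{e_r}}(\gamma)|=1.$$ Here $\lim_{|\gamma|\to 1^-}F(\gamma)=1$ means that for every $\varepsilon>0$ there is $\delta>0$ such that $|F(\gamma)-1|<\varepsilon$ for all $\gamma\in\mathbb H$ with $1-\delta<|\gamma|<1$. -/

import Mathlib

open Filter Topology
open scoped ENNReal Quaternion

noncomputable section

namespace QuaternionicBlaschke

/-- The class `𝓗_R` of quaternionic power series `∑ zᵏ f_k` (the variable commutes with the
coefficients) with `limsup_k |f_k|^{1/k} ≤ 1/R`. -/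
def powerSeriesClass (R : ℝ≥0∞) : Set (PowerSeries ℍ[ℝ]) :=
  {f | limsup (fun k : ℕ => ‖PowerSeries.coeff k f‖ₑ ^ (1 / (k : ℝ))) atTop ≤ R⁻¹}

/-- Left evaluation `∑ γᵏ f_k`. -/
def leftEval (f : PowerSeries ℍ[ℝ]) (γ : ℍ[ℝ]) : ℍ[ℝ] :=
  ∑' k : ℕ, γ ^ k * PowerSeries.coeff k f

/-- Right evaluation `∑ f_k γᵏ`. -/
def rightEval (f : PowerSeries ℍ[ℝ]) (γ : ℍ[ℝ]) : ℍ[ℝ] :=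
  ∑' k : ℕ, PowerSeries.coeff k f * γ ^ k

/-- For `f ∈ 𝓗_R` and `|γ| < R` the terms of the evaluation series are dominated by a convergent
geometric series. -/
theorem summable_norm_eval {R : ℝ≥0∞} {f : PowerSeries ℍ[ℝ]} (hf : f ∈ powerSeriesClass R)
    {γ : ℍ[ℝ]} (hγ : ‖γ‖ₑ < R) :
    Summable fun k : ℕ => ‖γ‖ ^ k * ‖PowerSeries.coeff k f‖ := by
  obtain ⟨r, hγr, hrR⟩ := ENNReal.lt_iff_exists_nnreal_btwn.1 hγ
  have hlt : limsup (fun k : ℕ => ‖PowerSeries.coeff k f‖ₑ ^ (1 / (k : ℝ))) atTop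
      < (r : ℝ≥0∞)⁻¹ := lt_of_le_of_lt hf (ENNReal.inv_lt_inv.2 hrR)
  have hr0 : r ≠ 0 := by
    rintro rfl
    simp at hγr
  have hγr' : ‖γ‖₊ < r := by
    rw [enorm_eq_nnnorm] at hγr
    exact_mod_cast hγr
  have hrpos : (0 : ℝ) < r := by
    exact_mod_cast pos_iff_ne_zero.2 hr0
  have hev := eventually_lt_of_limsup_lt hlt
  have hq : ‖γ‖ / (r : ℝ) < 1 := by
    rw [div_lt_one hrpos]
    exact_mod_cast hγr'
  refine Summable.of_norm_bounded_eventually_nat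
    (summable_geometric_of_lt_one (by positivity) hq) ?_
  filter_upwards [hev, eventually_ge_atTop 1] with k hk hk1
  have hkpos : (0 : ℝ) < k := by exact_mod_cast hk1
  have h1 : ‖PowerSeries.coeff k f‖₊ ≤ (r⁻¹) ^ k := by
    have h2 := ENNReal.rpow_le_rpow hk.le hkpos.le
    rw [← ENNReal.rpow_mul, one_div, inv_mul_cancel₀ hkpos.ne', ENNReal.rpow_one,
      ENNReal.rpow_natCast, enorm_eq_nnnorm, ← ENNReal.coe_inv hr0] at h2
    exact_mod_cast h2
  have h3 : ‖PowerSeries.coeff k f‖ ≤ ((r : ℝ)⁻¹) ^ k := by exact_mod_cast h1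
  rw [Real.norm_of_nonneg (by positivity), div_eq_mul_inv, mul_pow]
  gcongr

/-- The left evaluation series of `f ∈ 𝓗_R` converges at every `|γ| < R`. -/
theorem summable_leftEval {R : ℝ≥0∞} {f : PowerSeries ℍ[ℝ]} (hf : f ∈ powerSeriesClass R)
    {γ : ℍ[ℝ]} (hγ : ‖γ‖ₑ < R) :
    Summable fun k : ℕ => γ ^ k * PowerSeries.coeff k f :=
  Summable.of_norm (by simpa [norm_mul, norm_pow] using summable_norm_eval hf hγ)

/-- The right evaluation series of `f ∈ 𝓗_R` converges at every `|γ| < R`. -/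
theorem summable_rightEval {R : ℝ≥0∞} {f : PowerSeries ℍ[ℝ]} (hf : f ∈ powerSeriesClass R)
    {γ : ℍ[ℝ]} (hγ : ‖γ‖ₑ < R) :
    Summable fun k : ℕ => PowerSeries.coeff k f * γ ^ k :=
  Summable.of_norm (by simpa [norm_mul, norm_pow, mul_comm] using summable_norm_eval hf hγ)

/-- The Blaschke factor `𝐛_α(z) = (z - α) ∑ ᾱᵏ zᵏ = (z - α)(1 - z ᾱ)⁻¹`. -/
def blaschkeFactor (α : ℍ[ℝ]) : PowerSeries ℍ[ℝ] :=
  (PowerSeries.X - PowerSeries.C α) * PowerSeries.mk fun k => star α ^ k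

/-- Finite Blaschke products `𝐛_{α₁} ⋯ 𝐛_{αₙ} φ` with `|α_i| < 1`, `|φ| = 1` and `n ≥ 0`; the
product is the ordered one. -/
def IsFiniteBlaschkeProduct (f : PowerSeries ℍ[ℝ]) : Prop :=
  ∃ (l : List ℍ[ℝ]) (φ : ℍ[ℝ]), (∀ α ∈ l, ‖α‖ < 1) ∧ ‖φ‖ = 1 ∧
    f = (l.map blaschkeFactor).prod * PowerSeries.C φ

/-- The filter `|γ| → 1⁻` on the quaternions: the limit is uniform over directions, and all
points considered satisfy `|γ| < 1`. -/
def normToOneLeft : Filter ℍ[ℝ] := comap (fun γ : ℍ[ℝ] => ‖γ‖) (𝓝[<] 1)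

end QuaternionicBlaschke

end

/-!
A left value `f^{e_ℓ}(γ)` is a right value of `f` at a conjugate of `γ`, and conversely, so the two
boundary conditions are equivalent. Right evaluation is multiplicative up to conjugation:
`(p h)(γ) = p(v γ v⁻¹) v` with `v = h(γ)`. Hence a left zero `α` of a series of boundary modulus one
splits off a factor `𝐛_α` from the left, and the quotient again has boundary modulus one. All zeros
lie in a ball of some radius `r < 1`, so each division multiplies `|f(r)|` by at least a fixed
factor greater than one; as `|f(r)| ≤ 1` by the maximum principle, only finitely many divisions are
possible. What remains has no zeros and is a unimodular constant: the maximum principle gives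
`|f_0| ≤ 1`, the minimum principle for the real-coefficient series `f̄ f` gives `|f_0| ≥ 1`, and a
maximum of the modulus at the centre forces `f = f_0`.
-/

noncomputable section

namespace QuaternionicBlaschke

open PowerSeries

section DiscSummable

variable {R : Type*} [NormedRing R]

/-- Absolute convergence of the evaluation series on every disc of radius less than one. -/
def DiscSummable (f : PowerSeries R) : Prop :=
  ∀ r : ℝ, 0 ≤ r → r < 1 → Summable fun k => r ^ k * ‖coeff k f‖

theorem DiscSummable.mul {f g : PowerSeries R} (hf : DiscSummable f) (hg : DiscSummable g) :
    DiscSummable (f * g) := by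
  intro r hr0 hr1
  have hs := summable_sum_mul_antidiagonal_of_summable_mul
    (f := fun k => r ^ k * ‖coeff k f‖) (g := fun k => r ^ k * ‖coeff k g‖)
    ((hf r hr0 hr1).mul_of_nonneg (hg r hr0 hr1) (fun k => by positivity) fun k => by positivity)
  refine Summable.of_nonneg_of_le (fun k => by positivity) (fun k => ?_) hs
  calc r ^ k * ‖coeff k (f * g)‖
      ≤ r ^ k * ∑ p ∈ Finset.HasAntidiagonal.antidiagonal k, ‖coeff p.1 f‖ * ‖coeff p.2 g‖ := by
        rw [coeff_mul]
        gcongr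
        exact norm_sum_le_of_le _ fun p _ => norm_mul_le _ _
    _ = ∑ p ∈ Finset.HasAntidiagonal.antidiagonal k,
          r ^ p.1 * ‖coeff p.1 f‖ * (r ^ p.2 * ‖coeff p.2 g‖) := by
        rw [Finset.mul_sum]
        refine Finset.sum_congr rfl fun p hp => ?_
        rw [← Finset.HasAntidiagonal.mem_antidiagonal.1 hp, pow_add]
        ring

theorem discSummable_C_add_C_mul_X (a b : R) : DiscSummable (C a + C b * X) := by
  intro r _ _
  refine summable_of_ne_finset_zero (s := Finset.range 2) fun k hk => ?_
  have hk2 : 1 < k := by simpa using hk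
  simp [coeff_C, coeff_X, show k ≠ 0 by omega, show k ≠ 1 by omega]

theorem discSummable_mk_pow [NormOneClass R] {a : R} (ha : ‖a‖ < 1) :
    DiscSummable (PowerSeries.mk fun k => a ^ k) := by
  intro r hr0 hr1
  refine Summable.of_nonneg_of_le (fun k => by positivity) (fun k => ?_)
    (summable_geometric_of_lt_one hr0 hr1)
  rw [coeff_mk]
  exact mul_le_of_le_one_right (by positivity)
    ((norm_pow_le a k).trans (pow_le_one₀ (norm_nonneg a) ha.le))

theorem discSummable_of_eventually_bounded {f : PowerSeries R}
    (hf : ∀ᶠ t in 𝓝[<] (1 : ℝ), ∃ M, ∀ k, t ^ k * ‖coeff k f‖ ≤ M) : DiscSummable f := by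
  intro r hr0 hr1
  obtain ⟨t, ⟨M, hM⟩, hrt, -⟩ := (hf.and (Ioo_mem_nhdsLT hr1)).exists
  have ht : 0 < t := hr0.trans_lt hrt
  refine Summable.of_nonneg_of_le (fun k => by positivity) (fun k => ?_)
    ((summable_geometric_of_lt_one (by positivity) ((div_lt_one ht).2 hrt)).mul_left M)
  calc r ^ k * ‖coeff k f‖ = t ^ k * ‖coeff k f‖ * (r / t) ^ k := by
        rw [div_pow]
        field_simp
    _ ≤ M * (r / t) ^ k := by gcongr; exact hM k

end DiscSummable

section Evaluation

variable {f p h : PowerSeries ℍ[ℝ]} {γ : ℍ[ℝ]}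

theorem discSummable_of_mem_powerSeriesClass (hf : f ∈ powerSeriesClass 1) : DiscSummable f := by
  intro r hr0 hr1
  have hr : ‖(r : ℍ[ℝ])‖ = r := by rw [Quaternion.norm_coe, Real.norm_of_nonneg hr0]
  have hs := summable_norm_eval hf (γ := (r : ℍ[ℝ])) <| by
    rwa [← ofReal_norm, hr, ENNReal.ofReal_lt_one]
  rwa [hr] at hs

theorem DiscSummable.summable_leftEval (hf : DiscSummable f) (hγ : ‖γ‖ < 1) :
    Summable fun k => γ ^ k * coeff k f :=
  Summable.of_norm (by simpa only [norm_mul, norm_pow] using hf ‖γ‖ (norm_nonneg _) hγ)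

theorem rightEval_C_add_C_mul_X (a b γ : ℍ[ℝ]) : rightEval (C a + C b * X) γ = a + b * γ := by
  rw [rightEval, tsum_eq_sum (s := Finset.range 2)]
  · simp [Finset.sum_range_succ, coeff_C, coeff_X]
  · intro k hk
    have hk2 : 1 < k := by simpa using hk
    simp [coeff_C, coeff_X, show k ≠ 0 by omega, show k ≠ 1 by omega]

theorem rightEval_mul_eq_tsum (hp : DiscSummable p) (hh : DiscSummable h) (hγ : ‖γ‖ < 1) :
    rightEval (p * h) γ = ∑' i, coeff i p * rightEval h γ * γ ^ i := by
  set F : ℕ × ℕ → ℍ[ℝ] := fun x => coeff x.1 p * (coeff x.2 h * γ ^ x.2) * γ ^ x.1 with hF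
  have hFs : Summable F := by
    refine Summable.of_norm (((hp ‖γ‖ (norm_nonneg _) hγ).mul_of_nonneg
      (hh ‖γ‖ (norm_nonneg _) hγ) (fun k => by positivity) fun k => by positivity).congr
        fun x => ?_)
    simp only [hF, norm_mul, norm_pow]
    ring
  have h_diagonals : ∑' x, F x = rightEval (p * h) γ := by
    have hs : Summable fun x => F (Finset.HasAntidiagonal.sigmaAntidiagonalEquivProd x) :=
      Finset.HasAntidiagonal.sigmaAntidiagonalEquivProd.summable_iff.2 hFs
    rw [← Finset.HasAntidiagonal.sigmaAntidiagonalEquivProd.tsum_eq F,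
      hs.tsum_sigma' fun n => Summable.of_finite]
    refine tsum_congr fun n => ?_
    rw [tsum_fintype, coeff_mul, Finset.sum_mul,
      ← Finset.sum_coe_sort (Finset.HasAntidiagonal.antidiagonal n)]
    refine Finset.sum_congr rfl fun x _ => ?_
    have hγn : γ ^ n = γ ^ x.1.2 * γ ^ x.1.1 := by
      rw [← pow_add, add_comm, Finset.HasAntidiagonal.mem_antidiagonal.1 x.2]
    simp only [hF, hγn, Finset.HasAntidiagonal.sigmaAntidiagonalEquivProd_apply, mul_assoc]
  have h_rows : ∑' x, F x = ∑' i, coeff i p * rightEval h γ * γ ^ i := by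
    rw [hFs.tsum_prod]
    exact tsum_congr fun i => by
      simp only [hF, tsum_mul_right, tsum_mul_left, rightEval]
  rw [← h_diagonals, h_rows]

/-- With `v = h(γ)` one has `(p h)(γ) = ∑ p_i v γⁱ = p(v γ v⁻¹) v`. -/
theorem exists_rightEval_mul (hh : DiscSummable h) (hγ : ‖γ‖ < 1) :
    ∃ δ : ℍ[ℝ], ‖δ‖ = ‖γ‖ ∧
      ∀ p, DiscSummable p → rightEval (p * h) γ = rightEval p δ * rightEval h γ := by
  rcases eq_or_ne (rightEval h γ) 0 with hv | hv
  · exact ⟨γ, rfl, fun p hp => by simp [rightEval_mul_eq_tsum hp hh hγ, hv]⟩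
  · refine ⟨rightEval h γ * γ * (rightEval h γ)⁻¹, ?_, fun p hp => ?_⟩
    · rw [norm_mul, norm_mul, norm_inv]
      field_simp
    · rw [rightEval_mul_eq_tsum hp hh hγ, rightEval.eq_def p, ← tsum_mul_right]
      refine tsum_congr fun i => ?_
      have hconj : (rightEval h γ * γ * (rightEval h γ)⁻¹) ^ i
          = rightEval h γ * γ ^ i * (rightEval h γ)⁻¹ := by
        simpa only [inv_inv] using GroupWithZero.conj_pow₀ (inv_ne_zero hv)
      rw [hconj, mul_assoc _ _ (rightEval h γ), inv_mul_cancel_right₀ hv, mul_assoc]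

end Evaluation

section Conjugation

variable {f : PowerSeries ℍ[ℝ]} {γ : ℍ[ℝ]}

theorem exists_complexLiftAux_eq (γ : ℍ[ℝ]) :
    ∃ (I : ℍ[ℝ]) (hI : I * I = -1) (z : ℂ), Complex.liftAux I hI z = γ ∧ ‖z‖ = ‖γ‖ := by
  rcases eq_or_ne γ.im 0 with him | him
  · have hγ : γ = (γ.re : ℍ[ℝ]) := by simpa only [him, add_zero] using γ.re_add_im.symm
    have hI : ((Complex.I : ℂ) : ℍ[ℝ]) * Complex.I = -1 := by ext <;> simp
    refine ⟨Complex.I, hI, γ.re, ?_, ?_⟩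
    · rw [hγ]
      simp
    · rw [Complex.norm_real, ← Quaternion.norm_coe, ← hγ]
  · have hne : ‖γ.im‖ ≠ 0 := norm_ne_zero_iff.2 him
    have hI : ‖γ.im‖⁻¹ • γ.im * ‖γ.im‖⁻¹ • γ.im = -1 := by
      rw [smul_mul_smul_comm, ← sq γ.im, Quaternion.im_sq, Quaternion.normSq_eq_norm_mul_self,
        ← Quaternion.coe_neg, Quaternion.smul_coe, ← Quaternion.coe_one, ← Quaternion.coe_neg]
      congr 1
      field_simp
    refine ⟨‖γ.im‖⁻¹ • γ.im, hI, ⟨γ.re, ‖γ.im‖⟩, ?_, ?_⟩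
    · simp [Complex.liftAux_apply, hne, Quaternion.re_add_im]
    · rw [← sq_eq_sq₀ (norm_nonneg _) (norm_nonneg _), Complex.sq_norm, Complex.normSq_mk, sq ‖γ‖]
      simp only [← Quaternion.normSq_eq_norm_mul_self, Quaternion.normSq_def', Quaternion.re_im,
        Quaternion.imI_im, Quaternion.imJ_im, Quaternion.imK_im]
      ring

theorem exists_pow_eq_add_smul (γ : ℍ[ℝ]) :
    ∃ (I : ℍ[ℝ]) (a b : ℕ → ℝ), ∀ k, γ ^ k = (a k : ℍ[ℝ]) + b k • I ∧
      |a k| ≤ ‖γ‖ ^ k ∧ |b k| ≤ ‖γ‖ ^ k := by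
  obtain ⟨I, hI, z, rfl, hz⟩ := exists_complexLiftAux_eq γ
  refine ⟨I, fun k => (z ^ k).re, fun k => (z ^ k).im, fun k => ?_⟩
  rw [← hz, ← norm_pow]
  refine ⟨?_, Complex.abs_re_le_norm _, Complex.abs_im_le_norm _⟩
  rw [← map_pow, Complex.liftAux_apply]
  rfl

/-- If `γᵏ = a_k + b_k I` and `B = ∑ b_k f_k`, the conjugate `δ = B⁻¹ γ B` works, because
`I B = B (B⁻¹ I B)`. -/
theorem exists_rightEval_eq_leftEval (hf : DiscSummable f) (hγ : ‖γ‖ < 1) :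
    ∃ δ : ℍ[ℝ], ‖δ‖ = ‖γ‖ ∧ rightEval f δ = leftEval f γ := by
  obtain ⟨I, a, b, hab⟩ := exists_pow_eq_add_smul γ
  have hsummable : ∀ c : ℕ → ℝ, (∀ k, |c k| ≤ ‖γ‖ ^ k) → Summable fun k => c k • coeff k f :=
    fun c hc => Summable.of_norm_bounded (hf ‖γ‖ (norm_nonneg _) hγ) fun k => by
      rw [norm_smul, Real.norm_eq_abs]
      gcongr
      exact hc k
  have hA := hsummable a fun k => (hab k).2.1
  have hB := hsummable b fun k => (hab k).2.2
  set A := ∑' k, a k • coeff k f with hA_def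
  set B := ∑' k, b k • coeff k f with hB_def
  obtain ⟨δ, J, hδ, hδJ, hBJ⟩ : ∃ δ J : ℍ[ℝ], ‖δ‖ = ‖γ‖ ∧
      (∀ k, δ ^ k = (a k : ℍ[ℝ]) + b k • J) ∧ B * J = I * B := by
    rcases eq_or_ne B 0 with h0 | h0
    · exact ⟨γ, I, rfl, fun k => (hab k).1, by simp [h0]⟩
    · refine ⟨B⁻¹ * γ * B, B⁻¹ * I * B, ?_, fun k => ?_, ?_⟩
      · rw [norm_mul, norm_mul, norm_inv]
        field_simp
      · rw [GroupWithZero.conj_pow₀ h0, (hab k).1, mul_add, add_mul, mul_smul_comm,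
          smul_mul_assoc, mul_assoc B⁻¹ (a k : ℍ[ℝ]), Quaternion.coe_commutes,
          inv_mul_cancel_left₀ h0]
      · rw [mul_assoc, mul_inv_cancel_left₀ h0]
  have hleft : leftEval f γ = A + I * B := by
    rw [leftEval, hA_def, hB_def, ← tsum_mul_left, ← hA.tsum_add (hB.mul_left I)]
    refine tsum_congr fun k => ?_
    rw [(hab k).1, add_mul, Quaternion.coe_mul_eq_smul, smul_mul_assoc, mul_smul_comm]
  have hright : rightEval f δ = A + B * J := by
    rw [rightEval, hA_def, hB_def, ← tsum_mul_right, ← hA.tsum_add (hB.mul_right J)]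
    refine tsum_congr fun k => ?_
    rw [hδJ k, mul_add, Quaternion.mul_coe_eq_smul, smul_mul_assoc, mul_smul_comm]
  exact ⟨δ, hδ, by rw [hright, hleft, hBJ]⟩

/-- The power series with conjugate coefficients; conjugation exchanges left and right
evaluation. -/
def conjSeries (f : PowerSeries ℍ[ℝ]) : PowerSeries ℍ[ℝ] :=
  PowerSeries.mk fun k => star (coeff k f)

theorem DiscSummable.conjSeries (hf : DiscSummable f) :
    DiscSummable (conjSeries f) := by
  simpa only [DiscSummable, QuaternionicBlaschke.conjSeries, coeff_mk, norm_star] using hf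

theorem leftEval_conjSeries (f : PowerSeries ℍ[ℝ]) (γ : ℍ[ℝ]) :
    leftEval (conjSeries f) γ = star (rightEval f (star γ)) := by
  simp only [leftEval, rightEval, conjSeries, coeff_mk, tsum_star, star_mul, star_pow, star_star]

theorem rightEval_conjSeries (f : PowerSeries ℍ[ℝ]) (γ : ℍ[ℝ]) :
    rightEval (conjSeries f) γ = star (leftEval f (star γ)) := by
  simp only [leftEval, rightEval, conjSeries, coeff_mk, tsum_star, star_mul, star_pow, star_star]

theorem exists_leftEval_eq_rightEval (hf : DiscSummable f) (hγ : ‖γ‖ < 1) :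
    ∃ δ : ℍ[ℝ], ‖δ‖ = ‖γ‖ ∧ leftEval f δ = rightEval f γ := by
  obtain ⟨δ, hδ, h⟩ := exists_rightEval_eq_leftEval hf.conjSeries (γ := star γ) (by simpa using hγ)
  refine ⟨star δ, by simpa using hδ, star_injective ?_⟩
  rw [← rightEval_conjSeries, h, leftEval_conjSeries, star_star]

end Conjugation

section BoundaryFilter

theorem eventually_norm_lt_one : ∀ᶠ γ in normToOneLeft, ‖γ‖ < 1 :=
  tendsto_comap.eventually self_mem_nhdsWithin

theorem tendsto_norm_normToOneLeft : Tendsto (fun γ : ℍ[ℝ] => ‖γ‖) normToOneLeft (𝓝 1) :=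
  tendsto_comap.mono_right nhdsWithin_le_nhds

theorem tendsto_of_exists_norm_eq {α : Type*} {l : Filter α} {F G : ℍ[ℝ] → α}
    (hG : Tendsto G normToOneLeft l)
    (h : ∀ γ, ‖γ‖ < 1 → ∃ δ : ℍ[ℝ], ‖δ‖ = ‖γ‖ ∧ G δ = F γ) : Tendsto F normToOneLeft l := by
  choose! τ hτ hGF using h
  have hlim : Tendsto τ normToOneLeft normToOneLeft :=
    tendsto_comap_iff.2 <| tendsto_comap.congr' <|
      eventually_norm_lt_one.mono fun γ hγ => (hτ γ hγ).symm
  exact (hG.comp hlim).congr' (eventually_norm_lt_one.mono hGF)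

theorem tendsto_norm_leftEval_iff {f : PowerSeries ℍ[ℝ]} (hf : DiscSummable f)
    {l : Filter ℝ} :
    Tendsto (fun γ => ‖leftEval f γ‖) normToOneLeft l ↔
      Tendsto (fun γ => ‖rightEval f γ‖) normToOneLeft l := by
  constructor <;> intro h
  · refine tendsto_of_exists_norm_eq h fun γ hγ => ?_
    obtain ⟨δ, hδ, heq⟩ := exists_leftEval_eq_rightEval hf hγ
    exact ⟨δ, hδ, congrArg norm heq⟩
  · refine tendsto_of_exists_norm_eq h fun γ hγ => ?_
    obtain ⟨δ, hδ, heq⟩ := exists_rightEval_eq_leftEval hf hγ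
    exact ⟨δ, hδ, congrArg norm heq⟩

end BoundaryFilter

section Inner

variable {f p h : PowerSeries ℍ[ℝ]}

/-- Boundary modulus one on the unit ball, expressed by right evaluation; by
`tendsto_norm_leftEval_iff` left evaluation gives the same notion. -/
def IsInner (f : PowerSeries ℍ[ℝ]) : Prop :=
  DiscSummable f ∧ Tendsto (fun γ => ‖rightEval f γ‖) normToOneLeft (𝓝 1)

theorem IsInner.of_mul_left (hp : IsInner p) (hh : DiscSummable h) (hph : IsInner (p * h)) :
    IsInner h := by
  have hmul : ∀ γ : ℍ[ℝ], ‖γ‖ < 1 → ∃ δ : ℍ[ℝ], ‖δ‖ = ‖γ‖ ∧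
      rightEval (p * h) γ = rightEval p δ * rightEval h γ := fun γ hγ =>
    (exists_rightEval_mul hh hγ).imp fun δ hδ => ⟨hδ.1, hδ.2 p hp.1⟩
  choose! τ hτ hτmul using hmul
  have hpτ : Tendsto (fun γ => ‖rightEval p (τ γ)‖) normToOneLeft (𝓝 1) :=
    tendsto_of_exists_norm_eq hp.2 fun γ hγ => ⟨τ γ, hτ γ hγ, rfl⟩
  have hdiv := hph.2.div hpτ one_ne_zero
  rw [div_one] at hdiv
  refine ⟨hh, hdiv.congr' ?_⟩
  filter_upwards [hpτ.eventually_ne one_ne_zero, eventually_norm_lt_one] with γ hne hγ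
  rw [Pi.div_apply, hτmul γ hγ, norm_mul, mul_div_cancel_left₀ _ hne]

end Inner

section BlaschkeFactor

variable {α γ : ℍ[ℝ]}

theorem one_sub_C_mul_X_mul_mk_pow {R : Type*} [Ring R] (a : R) :
    (1 - C a * X) * PowerSeries.mk (fun k => a ^ k) = 1 := by
  ext n
  cases n with
  | zero => simp
  | succ n => simp [sub_mul, mul_assoc, coeff_succ_X_mul, pow_succ', coeff_one]

theorem mk_pow_mul_one_sub_C_mul_X {R : Type*} [Ring R] (a : R) :
    PowerSeries.mk (fun k => a ^ k) * (1 - C a * X) = 1 := by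
  ext n
  cases n with
  | zero => simp
  | succ n => simp [mul_sub, ← mul_assoc, coeff_succ_mul_X, pow_succ, coeff_one]

theorem discSummable_X_sub_C (α : ℍ[ℝ]) : DiscSummable (X - C α) := by
  simpa [neg_add_eq_sub] using discSummable_C_add_C_mul_X (-α) 1

theorem rightEval_X_sub_C (α γ : ℍ[ℝ]) : rightEval (X - C α) γ = γ - α := by
  simpa [neg_add_eq_sub] using rightEval_C_add_C_mul_X (-α) 1 γ

theorem discSummable_one_sub_C_mul_X (α : ℍ[ℝ]) : DiscSummable (1 - C α * X) := by
  simpa [sub_eq_add_neg] using discSummable_C_add_C_mul_X 1 (-α)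

theorem rightEval_one_sub_C_mul_X (α γ : ℍ[ℝ]) : rightEval (1 - C α * X) γ = 1 - α * γ := by
  simpa [sub_eq_add_neg] using rightEval_C_add_C_mul_X 1 (-α) γ

theorem discSummable_blaschkeFactor (hα : ‖α‖ < 1) : DiscSummable (blaschkeFactor α) :=
  (discSummable_X_sub_C α).mul (discSummable_mk_pow (by rwa [norm_star]))

theorem norm_one_sub_star_mul_sq_sub (α δ : ℍ[ℝ]) :
    ‖1 - star α * δ‖ ^ 2 - ‖δ - α‖ ^ 2 = (1 - ‖δ‖ ^ 2) * (1 - ‖α‖ ^ 2) := by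
  simp only [sq ‖_‖, ← Quaternion.normSq_eq_norm_mul_self, Quaternion.normSq_def']
  simp
  ring

/-- Numerator and denominator of `𝐛_α` both multiply the series `∑ ᾱᵏ zᵏ`, so they are evaluated
at the same point `δ`. -/
theorem exists_one_sub_norm_rightEval_blaschkeFactor_sq (hα : ‖α‖ < 1) (hγ : ‖γ‖ < 1) :
    ∃ δ : ℍ[ℝ], ‖δ‖ = ‖γ‖ ∧ 1 - ‖rightEval (blaschkeFactor α) γ‖ ^ 2 =
      (1 - ‖γ‖ ^ 2) * (1 - ‖α‖ ^ 2) / ‖1 - star α * δ‖ ^ 2 := by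
  obtain ⟨δ, hδ, hmul⟩ := exists_rightEval_mul (discSummable_mk_pow (a := star α)
    (by rwa [norm_star])) hγ
  have hnum := hmul _ (discSummable_X_sub_C α)
  have hden := hmul _ (discSummable_one_sub_C_mul_X (star α))
  have hone : rightEval 1 γ = 1 := by simpa using rightEval_C_add_C_mul_X 1 0 γ
  rw [one_sub_C_mul_X_mul_mk_pow, rightEval_one_sub_C_mul_X, hone] at hden
  rw [rightEval_X_sub_C] at hnum
  refine ⟨δ, hδ, ?_⟩
  have hden_norm := congrArg norm hden
  rw [norm_one, norm_mul] at hden_norm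
  have hne : ‖1 - star α * δ‖ ≠ 0 := left_ne_zero_of_mul_eq_one hden_norm.symm
  rw [blaschkeFactor, hnum, ← hδ, ← norm_one_sub_star_mul_sq_sub, norm_mul,
    eq_inv_of_mul_eq_one_right hden_norm.symm]
  field_simp

theorem one_sub_norm_le_norm_one_sub_star_mul {δ : ℍ[ℝ]} (hδ : ‖δ‖ < 1) :
    1 - ‖α‖ ≤ ‖1 - star α * δ‖ :=
  calc 1 - ‖α‖ ≤ 1 - ‖α‖ * ‖δ‖ := by nlinarith [norm_nonneg α]
    _ = ‖(1 : ℍ[ℝ])‖ - ‖star α * δ‖ := by rw [norm_one, norm_mul, norm_star]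
    _ ≤ ‖1 - star α * δ‖ := norm_sub_norm_le _ _

theorem norm_one_sub_star_mul_le_two {δ : ℍ[ℝ]} (hα : ‖α‖ < 1) (hδ : ‖δ‖ < 1) :
    ‖1 - star α * δ‖ ≤ 2 :=
  calc ‖1 - star α * δ‖ ≤ ‖(1 : ℍ[ℝ])‖ + ‖star α * δ‖ := norm_sub_le _ _
    _ = 1 + ‖α‖ * ‖δ‖ := by rw [norm_one, norm_mul, norm_star]
    _ ≤ 2 := by nlinarith [norm_nonneg α, norm_nonneg δ]

theorem norm_rightEval_blaschkeFactor_sq_mem_Icc (hα : ‖α‖ < 1) (hγ : ‖γ‖ < 1) :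
    ‖rightEval (blaschkeFactor α) γ‖ ^ 2 ∈
      Set.Icc (1 - (1 - ‖γ‖ ^ 2) * (1 - ‖α‖ ^ 2) / (1 - ‖α‖) ^ 2)
        (1 - (1 - ‖γ‖ ^ 2) * (1 - ‖α‖ ^ 2) / 2 ^ 2) := by
  obtain ⟨δ, hδ, h⟩ := exists_one_sub_norm_rightEval_blaschkeFactor_sq hα hγ
  have hδ1 : ‖δ‖ < 1 := hδ.trans_lt hγ
  have hα0 : 0 < 1 - ‖α‖ := sub_pos.2 hα
  have hlower := one_sub_norm_le_norm_one_sub_star_mul (α := α) hδ1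
  have hupper := norm_one_sub_star_mul_le_two hα hδ1
  have hnum : 0 ≤ (1 - ‖γ‖ ^ 2) * (1 - ‖α‖ ^ 2) :=
    mul_nonneg (sub_nonneg.2 (pow_le_one₀ (norm_nonneg γ) hγ.le))
      (sub_nonneg.2 (pow_le_one₀ (norm_nonneg α) hα.le))
  rw [← sub_sub_self 1 (‖rightEval (blaschkeFactor α) γ‖ ^ 2), h]
  have hD : 0 < ‖1 - star α * δ‖ := hα0.trans_le hlower
  constructor <;> gcongr

theorem isInner_blaschkeFactor (hα : ‖α‖ < 1) : IsInner (blaschkeFactor α) := by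
  refine ⟨discSummable_blaschkeFactor hα, ?_⟩
  have hbound : ∀ c : ℝ, Tendsto (fun γ : ℍ[ℝ] => 1 - (1 - ‖γ‖ ^ 2) * (1 - ‖α‖ ^ 2) / c)
      normToOneLeft (𝓝 1) := fun c => by
    simpa using ((((tendsto_norm_normToOneLeft.pow 2).const_sub 1).mul_const
      (1 - ‖α‖ ^ 2)).div_const c).const_sub 1
  have hsq : Tendsto (fun γ => ‖rightEval (blaschkeFactor α) γ‖ ^ 2) normToOneLeft (𝓝 1) :=
    tendsto_of_tendsto_of_tendsto_of_le_of_le' (hbound ((1 - ‖α‖) ^ 2)) (hbound (2 ^ 2))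
      (eventually_norm_lt_one.mono fun _ hγ => (norm_rightEval_blaschkeFactor_sq_mem_Icc hα hγ).1)
      (eventually_norm_lt_one.mono fun _ hγ => (norm_rightEval_blaschkeFactor_sq_mem_Icc hα hγ).2)
  simpa using hsq.sqrt

end BlaschkeFactor

section Division

variable {f : PowerSeries ℍ[ℝ]} {α : ℍ[ℝ]}

/-- The sums `∑_j αʲ f_{j+n}`; for `n ≥ 1` they are the coefficients of the quotient of `f` by
`z - α`. -/
def tailEval (f : PowerSeries ℍ[ℝ]) (α : ℍ[ℝ]) (n : ℕ) : ℍ[ℝ] :=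
  ∑' j, α ^ j * coeff (j + n) f

theorem norm_pow_mul_coeff_add_le (f : PowerSeries ℍ[ℝ]) {t : ℝ} (ht : 0 < t) (hαt : ‖α‖ ≤ t)
    (n j : ℕ) : ‖α ^ j * coeff (j + n) f‖ ≤ t ^ (j + n) * ‖coeff (j + n) f‖ / t ^ n :=
  calc ‖α ^ j * coeff (j + n) f‖ = ‖α‖ ^ j * ‖coeff (j + n) f‖ := by rw [norm_mul, norm_pow]
    _ ≤ t ^ j * ‖coeff (j + n) f‖ := by gcongr
    _ = t ^ (j + n) * ‖coeff (j + n) f‖ / t ^ n := by rw [pow_add]; field_simp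

theorem DiscSummable.summable_tailEval (hf : DiscSummable f) (hα : ‖α‖ < 1) (n : ℕ) :
    Summable fun j => α ^ j * coeff (j + n) f := by
  obtain ⟨t, hαt, ht1⟩ := exists_between hα
  have ht0 : 0 < t := (norm_nonneg α).trans_lt hαt
  exact Summable.of_norm_bounded
    (((summable_nat_add_iff n).2 (hf t ht0.le ht1)).div_const (t ^ n))
    (norm_pow_mul_coeff_add_le f ht0 hαt.le n)

theorem DiscSummable.pow_mul_norm_tailEval_le (hf : DiscSummable f) {t : ℝ} (ht0 : 0 < t)
    (ht1 : t < 1) (hαt : ‖α‖ ≤ t) (n : ℕ) :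
    t ^ n * ‖tailEval f α n‖ ≤ ∑' k, t ^ k * ‖coeff k f‖ := by
  have hs := hf t ht0.le ht1
  have hnorm := tsum_of_norm_bounded (((summable_nat_add_iff n).2 hs).div_const (t ^ n)).hasSum
    (norm_pow_mul_coeff_add_le f ht0 hαt n)
  rw [tsum_div_const, le_div_iff₀' (by positivity)] at hnorm
  exact hnorm.trans
    (tsum_comp_le_tsum_of_inj hs (fun k => by positivity) (add_left_injective n))

theorem DiscSummable.tailEval_eq_coeff_add (hf : DiscSummable f) (hα : ‖α‖ < 1) (n : ℕ) :
    tailEval f α n = coeff n f + α * tailEval f α (n + 1) := by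
  rw [tailEval, (hf.summable_tailEval hα n).tsum_eq_zero_add, tailEval, ← tsum_mul_left]
  simp only [pow_zero, one_mul, zero_add, pow_succ', mul_assoc, add_right_comm, add_assoc]

theorem DiscSummable.exists_eq_X_sub_C_mul (hf : DiscSummable f) (hα : ‖α‖ < 1)
    (h0 : leftEval f α = 0) : ∃ h, DiscSummable h ∧ f = (X - C α) * h := by
  refine ⟨PowerSeries.mk fun k => tailEval f α (k + 1), ?_, ?_⟩
  · refine discSummable_of_eventually_bounded ?_
    filter_upwards [Ioo_mem_nhdsLT (max_lt hα one_pos)] with t ht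
    obtain ⟨hαt, ht0⟩ := max_lt_iff.1 ht.1
    refine ⟨(∑' k, t ^ k * ‖coeff k f‖) / t, fun k => ?_⟩
    rw [coeff_mk, le_div_iff₀' ht0, ← mul_assoc, ← pow_succ']
    exact hf.pow_mul_norm_tailEval_le ht0 ht.2 hαt.le (k + 1)
  · ext1 n
    cases n with
    | zero =>
      have h := hf.tailEval_eq_coeff_add hα 0
      rw [show tailEval f α 0 = leftEval f α from rfl, h0] at h
      simp [sub_mul, eq_neg_of_add_eq_zero_left h.symm]
    | succ n => simp [sub_mul, coeff_succ_X_mul, hf.tailEval_eq_coeff_add hα (n + 1)]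

theorem IsInner.exists_eq_blaschkeFactor_mul (hf : IsInner f) (hα : ‖α‖ < 1)
    (h0 : leftEval f α = 0) : ∃ h, IsInner h ∧ f = blaschkeFactor α * h := by
  obtain ⟨q, hq, rfl⟩ := hf.1.exists_eq_X_sub_C_mul hα h0
  have hfactor : (X - C α) * q = blaschkeFactor α * ((1 - C (star α) * X) * q) := by
    rw [blaschkeFactor, mul_assoc, ← mul_assoc (PowerSeries.mk _), mk_pow_mul_one_sub_C_mul_X,
      one_mul]
  exact ⟨(1 - C (star α) * X) * q, (isInner_blaschkeFactor hα).of_mul_left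
    ((discSummable_one_sub_C_mul_X _).mul hq) (hfactor ▸ hf), hfactor⟩

end Division

section ComplexAnalysis

variable {E : Type*} [NormedAddCommGroup E] [NormedSpace ℂ E]

theorem hasFPowerSeriesOnBall_tsum_pow_smul [CompleteSpace E] {a : ℕ → E}
    (ha : ∀ r : ℝ, 0 ≤ r → r < 1 → Summable fun k => r ^ k * ‖a k‖) :
    HasFPowerSeriesOnBall (fun z : ℂ => ∑' k, z ^ k • a k)
      (fun n => ContinuousMultilinearMap.mkPiRing ℂ (Fin n) (a n)) 0 1 where
  r_le := by
    refine ENNReal.le_of_forall_nnreal_lt fun r hr => ?_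
    refine FormalMultilinearSeries.le_radius_of_summable_norm _ ?_
    simpa only [ContinuousMultilinearMap.norm_mkPiRing, mul_comm] using
      ha r r.coe_nonneg (by exact_mod_cast hr)
  r_pos := one_pos
  hasSum {z} hz := by
    have hz1 : ‖z‖ < 1 := by simpa [enorm_eq_nnnorm, ← NNReal.coe_lt_one] using hz
    have hs : Summable fun k => z ^ k • a k :=
      Summable.of_norm (by simpa only [norm_smul, norm_pow] using ha ‖z‖ (norm_nonneg _) hz1)
    simpa using hs.hasSum

theorem differentiableOn_tsum_pow_smul [CompleteSpace E] {a : ℕ → E}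
    (ha : ∀ r : ℝ, 0 ≤ r → r < 1 → Summable fun k => r ^ k * ‖a k‖) :
    DifferentiableOn ℂ (fun z : ℂ => ∑' k, z ^ k • a k) (Metric.ball 0 1) := by
  simpa only [← Metric.eball_ofReal, ENNReal.ofReal_one] using
    (hasFPowerSeriesOnBall_tsum_pow_smul ha).differentiableOn

variable {F : ℂ → E} {c : ℝ} {z : ℂ}

theorem norm_le_of_tendsto_norm (hF : DifferentiableOn ℂ F (Metric.ball 0 1))
    (hlim : Tendsto (fun z => ‖F z‖) (comap (‖·‖) (𝓝[<] 1)) (𝓝 c)) (hz : ‖z‖ < 1) :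
    ‖F z‖ ≤ c := by
  refine le_of_forall_pos_le_add fun ε hε => ?_
  have hev := eventually_comap.1 (hlim.eventually_le_const (lt_add_of_pos_right c hε))
  obtain ⟨x, hx, hzx, hx1⟩ := (hev.and (Ioo_mem_nhdsLT hz)).exists
  have hx0 : x ≠ 0 := ((norm_nonneg z).trans_lt hzx).ne'
  refine Complex.norm_le_of_forall_mem_frontier_norm_le (U := Metric.ball 0 x)
    Metric.isBounded_ball ⟨hF.mono (Metric.ball_subset_ball hx1.le), ?_⟩ (fun w hw => ?_)
    (subset_closure (by simpa using hzx))
  · rw [closure_ball _ hx0]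
    exact hF.continuousOn.mono (Metric.closedBall_subset_ball hx1)
  · rw [frontier_ball _ hx0] at hw
    exact hx w (by simpa using hw)

theorem le_norm_of_tendsto_norm {F : ℂ → ℂ} (hF : DifferentiableOn ℂ F (Metric.ball 0 1))
    (hF0 : ∀ z, ‖z‖ < 1 → F z ≠ 0) (hc : 0 < c)
    (hlim : Tendsto (fun z => ‖F z‖) (comap (‖·‖) (𝓝[<] 1)) (𝓝 c)) (hz : ‖z‖ < 1) :
    c ≤ ‖F z‖ := by
  have hinv := norm_le_of_tendsto_norm (hF.inv fun w hw => hF0 w (by simpa using hw))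
    (by simpa only [Pi.inv_apply, norm_inv] using hlim.inv₀ hc.ne') hz
  rwa [Pi.inv_apply, norm_inv, inv_le_inv₀ (norm_pos_iff.2 (hF0 z hz)) hc] at hinv

end ComplexAnalysis

section Slice

variable {f : PowerSeries ℍ[ℝ]}

theorem norm_coeComplex (z : ℂ) : ‖(z : ℍ[ℝ])‖ = ‖z‖ := by
  rw [← sq_eq_sq₀ (norm_nonneg _) (norm_nonneg _), sq, ← Quaternion.normSq_eq_norm_mul_self,
    Quaternion.normSq_def', Complex.sq_norm, Complex.normSq_apply]
  simp
  ring

theorem coeComplex_pow (z : ℂ) (k : ℕ) : ((z ^ k : ℂ) : ℍ[ℝ]) = (z : ℍ[ℝ]) ^ k :=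
  map_pow Quaternion.ofComplex z k

theorem tendsto_coeComplex_normToOneLeft :
    Tendsto (fun z : ℂ => (z : ℍ[ℝ])) (comap (‖·‖) (𝓝[<] 1)) normToOneLeft :=
  tendsto_comap_iff.2 (tendsto_comap.congr fun z => (norm_coeComplex z).symm)

/-- The quaternions as a complex plane `ℂ²`, with `ℂ ⊆ ℍ` acting by left multiplication:
`a + b i + c j + d k = (a + b i) + (c + d i) j`. -/
def complexify : ℍ[ℝ] →ₗᵢ[ℝ] EuclideanSpace ℂ (Fin 2) where
  toFun q := !₂[⟨q.re, q.imI⟩, ⟨q.imJ, q.imK⟩]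
  map_add' p q := by
    ext i
    fin_cases i <;> rfl
  map_smul' r q := by
    ext i
    fin_cases i <;> simp [Complex.ext_iff]
  norm_map' q := by
    rw [← sq_eq_sq₀ (norm_nonneg _) (norm_nonneg _), EuclideanSpace.norm_sq_eq, sq ‖q‖,
      ← Quaternion.normSq_eq_norm_mul_self, Quaternion.normSq_def']
    simp [Complex.sq_norm, Complex.normSq_apply]
    ring

theorem complexify_coeComplex_mul (z : ℂ) (q : ℍ[ℝ]) :
    complexify (z * q) = z • complexify q := by
  ext i
  fin_cases i <;> simp [complexify, Complex.ext_iff]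

theorem DiscSummable.complexify_leftEval (hf : DiscSummable f) {z : ℂ} (hz : ‖z‖ < 1) :
    complexify (leftEval f z) = ∑' k, z ^ k • complexify (coeff k f) := by
  have hs := hf.summable_leftEval (γ := z) (by rwa [norm_coeComplex])
  have hmap := complexify.toContinuousLinearMap.map_tsum hs
  rw [leftEval]
  simpa only [← coeComplex_pow, LinearIsometry.coe_toContinuousLinearMap,
    complexify_coeComplex_mul] using hmap

theorem DiscSummable.hasFPowerSeriesOnBall_complexify_leftEval (hf : DiscSummable f) :
    HasFPowerSeriesOnBall (fun z : ℂ => complexify (leftEval f z))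
      (fun n => ContinuousMultilinearMap.mkPiRing ℂ (Fin n) (complexify (coeff n f))) 0 1 := by
  refine (hasFPowerSeriesOnBall_tsum_pow_smul fun r hr0 hr1 => ?_).congr fun z hz => ?_
  · simpa only [LinearIsometry.norm_map] using hf r hr0 hr1
  · exact (hf.complexify_leftEval (by simpa [enorm_eq_nnnorm, ← NNReal.coe_lt_one] using hz)).symm

theorem DiscSummable.differentiableOn_complexify_leftEval (hf : DiscSummable f) :
    DifferentiableOn ℂ (fun z : ℂ => complexify (leftEval f z)) (Metric.ball 0 1) :=
  (differentiableOn_tsum_pow_smul fun r hr0 hr1 => by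
    simpa only [LinearIsometry.norm_map] using hf r hr0 hr1).congr
      fun z hz => hf.complexify_leftEval (by simpa using hz)

theorem IsInner.norm_leftEval_coeComplex_le_one (hf : IsInner f) {z : ℂ} (hz : ‖z‖ < 1) :
    ‖leftEval f z‖ ≤ 1 := by
  have hlim := ((tendsto_norm_leftEval_iff hf.1).2 hf.2).comp tendsto_coeComplex_normToOneLeft
  rw [← complexify.norm_map]
  exact norm_le_of_tendsto_norm hf.1.differentiableOn_complexify_leftEval
    (by simpa only [Function.comp_def, LinearIsometry.norm_map] using hlim) hz

theorem leftEval_zero (f : PowerSeries ℍ[ℝ]) : leftEval f 0 = coeff 0 f := by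
  rw [leftEval, tsum_eq_single 0 fun k hk => by simp [hk]]
  simp

theorem rightEval_zero (f : PowerSeries ℍ[ℝ]) : rightEval f 0 = coeff 0 f := by
  rw [rightEval, tsum_eq_single 0 fun k hk => by simp [hk]]
  simp

theorem IsInner.norm_coeff_zero_le_one (hf : IsInner f) : ‖coeff 0 f‖ ≤ 1 := by
  simpa [leftEval_zero] using hf.norm_leftEval_coeComplex_le_one (z := 0) (by simp)

theorem IsInner.eq_C (hf : IsInner f) (h1 : 1 ≤ ‖coeff 0 f‖) : f = C (coeff 0 f) := by
  have hps := hf.1.hasFPowerSeriesOnBall_complexify_leftEval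
  have hconst : Set.EqOn (fun z : ℂ => complexify (leftEval f z))
      (Function.const ℂ (complexify (coeff 0 f))) (Metric.ball 0 1) := by
    have hmax : IsMaxOn (norm ∘ fun z : ℂ => complexify (leftEval f z)) (Metric.ball 0 1) 0 :=
      fun z hz => by
        simpa [leftEval_zero] using
          (hf.norm_leftEval_coeComplex_le_one (by simpa using hz)).trans h1
    simpa [leftEval_zero] using Complex.eqOn_of_isPreconnected_of_isMaxOn_norm
      (convex_ball (0 : ℂ) 1).isPreconnected Metric.isOpen_ball
      hf.1.differentiableOn_complexify_leftEval (Metric.mem_ball_self one_pos) hmax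
  have hseries := hps.hasFPowerSeriesAt.eq_formalMultilinearSeries_of_eventually
    hasFPowerSeriesAt_const
    (hconst.eventuallyEq_of_mem (Metric.ball_mem_nhds 0 one_pos))
  ext1 n
  rcases eq_or_ne n 0 with rfl | hn
  · simp
  · have hcoeff := congrArg (fun p : FormalMultilinearSeries ℂ ℂ _ => p.coeff n) hseries
    have hzero : complexify (coeff n f) = 0 := by
      simpa [FormalMultilinearSeries.coeff, constFormalMultilinearSeries_apply_of_nonzero hn]
        using hcoeff
    rw [coeff_C, if_neg hn]
    exact (map_eq_zero_iff complexify complexify.injective).1 hzero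

end Slice

section MinimumModulus

variable {f : PowerSeries ℍ[ℝ]} {γ : ℍ[ℝ]}

theorem star_coeff_conjSeries_mul_self (f : PowerSeries ℍ[ℝ]) (n : ℕ) :
    star (coeff n (conjSeries f * f)) = coeff n (conjSeries f * f) := by
  rw [coeff_mul, star_sum, ← Finset.Nat.sum_antidiagonal_swap]
  simp [conjSeries, coeff_mk]

theorem exists_norm_rightEval_conjSeries_mul_self (hf : DiscSummable f) (hγ : ‖γ‖ < 1) :
    ∃ δ : ℍ[ℝ], ‖δ‖ = ‖γ‖ ∧
      ‖rightEval (conjSeries f * f) γ‖ = ‖leftEval f δ‖ * ‖rightEval f γ‖ := by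
  obtain ⟨δ, hδ, hmul⟩ := exists_rightEval_mul hf hγ
  refine ⟨star δ, by rw [norm_star, hδ], ?_⟩
  rw [hmul _ hf.conjSeries, norm_mul, rightEval_conjSeries, norm_star]

theorem IsInner.tendsto_norm_rightEval_conjSeries_mul_self (hf : IsInner f) :
    Tendsto (fun γ => ‖rightEval (conjSeries f * f) γ‖) normToOneLeft (𝓝 1) := by
  choose! τ hτ hτmul using fun γ hγ => exists_norm_rightEval_conjSeries_mul_self (γ := γ) hf.1 hγ
  have hleft : Tendsto (fun γ => ‖leftEval f (τ γ)‖) normToOneLeft (𝓝 1) :=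
    tendsto_of_exists_norm_eq ((tendsto_norm_leftEval_iff hf.1).2 hf.2) fun γ hγ =>
      ⟨τ γ, hτ γ hγ, rfl⟩
  have hprod := hleft.mul hf.2
  rw [mul_one] at hprod
  exact hprod.congr' (eventually_norm_lt_one.mono fun γ hγ => (hτmul γ hγ).symm)

theorem continuous_coeComplex : Continuous ((↑) : ℂ → ℍ[ℝ]) :=
  (AddMonoidHomClass.isometry_of_norm Quaternion.ofComplex norm_coeComplex).continuous

theorem norm_re_le_norm (q : ℍ[ℝ]) : ‖q.re‖ ≤ ‖q‖ := by
  simpa [Quaternion.inner_def] using norm_inner_le_norm (𝕜 := ℝ) q 1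

theorem DiscSummable.summable_norm_re (hf : DiscSummable f) {r : ℝ} (hr0 : 0 ≤ r) (hr1 : r < 1) :
    Summable fun k => r ^ k * ‖((coeff k f).re : ℂ)‖ := by
  refine Summable.of_nonneg_of_le (fun k => by positivity) (fun k => ?_) (hf r hr0 hr1)
  rw [Complex.norm_real]
  gcongr
  exact norm_re_le_norm _

theorem rightEval_coeComplex_of_star_coeff_eq {N : PowerSeries ℍ[ℝ]} (hN : DiscSummable N)
    (hstar : ∀ n, star (coeff n N) = coeff n N) {z : ℂ} (hz : ‖z‖ < 1) :
    rightEval N z = ((∑' k, z ^ k • ((coeff k N).re : ℂ) : ℂ) : ℍ[ℝ]) := by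
  have hs : Summable fun k => z ^ k • ((coeff k N).re : ℂ) :=
    Summable.of_norm (by
      simpa only [norm_smul, norm_pow] using hN.summable_norm_re (norm_nonneg z) hz)
  have hmap := hs.map_tsum Quaternion.ofComplex continuous_coeComplex
  rw [rightEval, ← Quaternion.coe_ofComplex, hmap]
  refine tsum_congr fun k => ?_
  rw [smul_eq_mul, Quaternion.coe_ofComplex, Quaternion.coeComplex_mul, Quaternion.coeComplex_coe,
    coeComplex_pow, ← Quaternion.coe_commutes, ← Quaternion.star_eq_self.1 (hstar k)]

theorem rightEval_conjSeries_mul_self_ne_zero (hf : DiscSummable f)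
    (hne : ∀ γ, ‖γ‖ < 1 → rightEval f γ ≠ 0) (hγ : ‖γ‖ < 1) :
    rightEval (conjSeries f * f) γ ≠ 0 := by
  obtain ⟨δ, hδ, hmul⟩ := exists_norm_rightEval_conjSeries_mul_self hf hγ
  obtain ⟨β, hβ, hleft⟩ := exists_rightEval_eq_leftEval hf (hδ.trans_lt hγ)
  rw [← norm_ne_zero_iff, hmul, ← hleft]
  exact mul_ne_zero (norm_ne_zero_iff.2 (hne β ((hβ.trans hδ).trans_lt hγ)))
    (norm_ne_zero_iff.2 (hne γ hγ))

/-- The coefficients of `f̄ f` are real, so on `ℂ ⊆ ℍ` it is a scalar holomorphic function, to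
which the minimum modulus principle applies. -/
theorem IsInner.one_le_norm_coeff_zero (hf : IsInner f)
    (hne : ∀ γ, ‖γ‖ < 1 → rightEval f γ ≠ 0) : 1 ≤ ‖coeff 0 f‖ := by
  have hN : DiscSummable (conjSeries f * f) := hf.1.conjSeries.mul hf.1
  set G : ℂ → ℂ := fun z => ∑' k, z ^ k • ((coeff k (conjSeries f * f)).re : ℂ)
  have hG : DifferentiableOn ℂ G (Metric.ball 0 1) :=
    differentiableOn_tsum_pow_smul fun _ => hN.summable_norm_re
  have hG_norm : ∀ z : ℂ, ‖z‖ < 1 → ‖G z‖ = ‖rightEval (conjSeries f * f) z‖ := fun z hz => by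
    rw [rightEval_coeComplex_of_star_coeff_eq hN (star_coeff_conjSeries_mul_self f) hz,
      norm_coeComplex]
  have hG_ne : ∀ z, ‖z‖ < 1 → G z ≠ 0 := fun z hz => by
    rw [← norm_ne_zero_iff, hG_norm z hz, norm_ne_zero_iff]
    exact rightEval_conjSeries_mul_self_ne_zero hf.1 hne (by rwa [norm_coeComplex])
  have hG_lim : Tendsto (fun z => ‖G z‖) (comap (‖·‖) (𝓝[<] 1)) (𝓝 1) := by
    refine (hf.tendsto_norm_rightEval_conjSeries_mul_self.comp
      tendsto_coeComplex_normToOneLeft).congr' ?_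
    filter_upwards [preimage_mem_comap self_mem_nhdsWithin] with z hz using (hG_norm z hz).symm
  have hG_zero : ‖G 0‖ = ‖coeff 0 f‖ ^ 2 := by
    rw [hG_norm 0 (by simp), Quaternion.coeComplex_zero, rightEval_zero]
    simp [conjSeries, coeff_mul, sq]
  exact (one_le_sq_iff₀ (norm_nonneg _)).1
    (hG_zero ▸ le_norm_of_tendsto_norm hG hG_ne one_pos hG_lim (by simp))

end MinimumModulus

section Factorization

variable {f h : PowerSeries ℍ[ℝ]} {α : ℍ[ℝ]}

theorem IsInner.isFiniteBlaschkeProduct_of_rightEval_ne_zero (hf : IsInner f)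
    (hne : ∀ γ, ‖γ‖ < 1 → rightEval f γ ≠ 0) : IsFiniteBlaschkeProduct f := by
  have h1 := hf.one_le_norm_coeff_zero hne
  exact ⟨[], coeff 0 f, by simp, hf.norm_coeff_zero_le_one.antisymm h1, by
    simpa using hf.eq_C h1⟩

theorem IsFiniteBlaschkeProduct.blaschkeFactor_mul (hh : IsFiniteBlaschkeProduct h)
    (hα : ‖α‖ < 1) : IsFiniteBlaschkeProduct (blaschkeFactor α * h) := by
  obtain ⟨l, φ, hl, hφ, rfl⟩ := hh
  exact ⟨α :: l, φ, by simpa [hα] using hl, hφ, by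
    rw [List.map_cons, List.prod_cons, mul_assoc]⟩

theorem IsInner.norm_rightEval_coe_le_one (hf : IsInner f) {r : ℝ} (hr : ‖r‖ < 1) :
    ‖rightEval f r‖ ≤ 1 := by
  have hcomm : rightEval f r = leftEval f ((r : ℂ) : ℍ[ℝ]) := by
    rw [rightEval, leftEval, Quaternion.coeComplex_coe]
    exact tsum_congr fun k => by rw [← Quaternion.coe_pow, Quaternion.coe_commutes]
  rw [hcomm]
  exact hf.norm_leftEval_coeComplex_le_one (by rwa [Complex.norm_real])

theorem norm_rightEval_blaschkeFactor_mul_sq_le (hh : DiscSummable h) {γ : ℍ[ℝ]} {r : ℝ}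
    (hr : r < 1) (hα : ‖α‖ ≤ r) (hγ : ‖γ‖ ≤ r) :
    ‖rightEval (blaschkeFactor α * h) γ‖ ^ 2 ≤
      (1 - (1 - r ^ 2) ^ 2 / 2 ^ 2) * ‖rightEval h γ‖ ^ 2 := by
  have hα1 := hα.trans_lt hr
  have hγ1 := hγ.trans_lt hr
  have hr0 : 0 ≤ r := (norm_nonneg α).trans hα
  obtain ⟨δ, hδ, hmul⟩ := exists_rightEval_mul hh hγ1
  have hδ1 : ‖δ‖ < 1 := hδ.trans_lt hγ1
  rw [hmul _ (discSummable_blaschkeFactor hα1), norm_mul, mul_pow]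
  refine mul_le_mul_of_nonneg_right
    ((norm_rightEval_blaschkeFactor_sq_mem_Icc hα1 hδ1).2.trans ?_) (by positivity)
  have hr2 : 0 ≤ 1 - r ^ 2 := sub_nonneg.2 (pow_le_one₀ hr0 hr.le)
  have hγ2 : 0 ≤ 1 - ‖γ‖ ^ 2 := sub_nonneg.2 (pow_le_one₀ (norm_nonneg γ) hγ1.le)
  rw [hδ, sq (1 - r ^ 2)]
  gcongr

/-- Dividing `f` by the Blaschke factor of a zero in the ball of radius `r` multiplies `|f(r)|²`
by at least `(1 - (1 - r²)² / 4)⁻¹`, and `|f(r)| ≤ 1` throughout. -/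
theorem IsInner.isFiniteBlaschkeProduct_of_pow_lt {r : ℝ} (hr0 : 0 ≤ r) (hr1 : r < 1) (n : ℕ)
    (hf : IsInner f) (hne : ∀ γ, r ≤ ‖γ‖ → ‖γ‖ < 1 → rightEval f γ ≠ 0)
    (hn : (1 - (1 - r ^ 2) ^ 2 / 2 ^ 2) ^ n < ‖rightEval f r‖ ^ 2) :
    IsFiniteBlaschkeProduct f := by
  have hr_norm : ‖(r : ℍ[ℝ])‖ = r := by rw [Quaternion.norm_coe, Real.norm_of_nonneg hr0]
  induction n generalizing f with
  | zero =>
    have hle := hf.norm_rightEval_coe_le_one (r := r) (by rwa [Real.norm_of_nonneg hr0])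
    rw [pow_zero] at hn
    exact absurd hn (pow_le_one₀ (norm_nonneg _) hle).not_gt
  | succ n ih =>
    by_cases hzero : ∀ γ, ‖γ‖ < 1 → rightEval f γ ≠ 0
    · exact hf.isFiniteBlaschkeProduct_of_rightEval_ne_zero hzero
    push Not at hzero
    obtain ⟨γ, hγ1, hγ0⟩ := hzero
    have hγr : ‖γ‖ < r := lt_of_not_ge fun hle => hne γ hle hγ1 hγ0
    obtain ⟨α, hα, hα0⟩ := exists_leftEval_eq_rightEval hf.1 hγ1
    have hα1 : ‖α‖ < 1 := hα.trans_lt hγ1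
    obtain ⟨h, hh, rfl⟩ := hf.exists_eq_blaschkeFactor_mul hα1 (hα0.trans hγ0)
    refine (ih hh (fun β hβr hβ1 hβ0 => hne β hβr hβ1 ?_) ?_).blaschkeFactor_mul hα1
    · obtain ⟨δ, -, hmul⟩ := exists_rightEval_mul hh.1 hβ1
      rw [hmul _ (discSummable_blaschkeFactor hα1), hβ0, mul_zero]
    · have hgain := hn.trans_le (norm_rightEval_blaschkeFactor_mul_sq_le hh.1 hr1
        (hα.trans_lt hγr).le hr_norm.le)
      rw [pow_succ'] at hgain
      have hr2 : r ^ 2 ≤ 1 := pow_le_one₀ hr0 hr1.le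
      exact lt_of_mul_lt_mul_left hgain (by nlinarith [sq_nonneg r])

theorem IsInner.isFiniteBlaschkeProduct (hf : IsInner f) : IsFiniteBlaschkeProduct f := by
  obtain ⟨l, hl, hne⟩ := mem_nhdsLT_iff_exists_Ico_subset.1
    (eventually_comap.1 (hf.2.eventually_ne one_ne_zero))
  set r := max l 0
  have hr0 : 0 ≤ r := le_max_right l 0
  have hr1 : r < 1 := max_lt hl one_pos
  have hne_zero : ∀ γ, r ≤ ‖γ‖ → ‖γ‖ < 1 → rightEval f γ ≠ 0 := fun γ hγr hγ1 =>
    norm_ne_zero_iff.1 (hne ⟨(le_max_left l 0).trans hγr, hγ1⟩ γ rfl)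
  have hr_norm : ‖(r : ℍ[ℝ])‖ = r := by rw [Quaternion.norm_coe, Real.norm_of_nonneg hr0]
  have hpos : 0 < ‖rightEval f r‖ ^ 2 :=
    pow_pos (norm_pos_iff.2 (hne_zero r hr_norm.ge (hr_norm.trans_lt hr1))) 2
  have hlt : 1 - (1 - r ^ 2) ^ 2 / 2 ^ 2 < 1 := by
    have hr2 : 0 < 1 - r ^ 2 := sub_pos.2 (pow_lt_one₀ hr0 hr1 two_ne_zero)
    exact sub_lt_self _ (by positivity)
  obtain ⟨n, hn⟩ := exists_pow_lt_of_lt_one hpos hlt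
  exact hf.isFiniteBlaschkeProduct_of_pow_lt hr0 hr1 n hne_zero hn

end Factorization

end QuaternionicBlaschke

end

theorem theorem3 (f : PowerSeries ℍ[ℝ]) (hf : f ∈ QuaternionicBlaschke.powerSeriesClass 1) :
    (Tendsto (fun γ : ℍ[ℝ] => ‖QuaternionicBlaschke.leftEval f γ‖)
        QuaternionicBlaschke.normToOneLeft (𝓝 (1 : ℝ)) →
      QuaternionicBlaschke.IsFiniteBlaschkeProduct f) ∧
    (Tendsto (fun γ : ℍ[ℝ] => ‖QuaternionicBlaschke.leftEval f γ‖)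
        QuaternionicBlaschke.normToOneLeft (𝓝 (1 : ℝ)) ↔
      Tendsto (fun γ : ℍ[ℝ] => ‖QuaternionicBlaschke.rightEval f γ‖)
        QuaternionicBlaschke.normToOneLeft (𝓝 (1 : ℝ))) := by
  have hs := QuaternionicBlaschke.discSummable_of_mem_powerSeriesClass hf
  have hiff := QuaternionicBlaschke.tendsto_norm_leftEval_iff hs (l := 𝓝 1)
  exact ⟨fun hleft => QuaternionicBlaschke.IsInner.isFiniteBlaschkeProduct ⟨hs, hiff.1 hleft⟩, hiff⟩
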